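/- Let $\mathbb{K}$ be an algebraically closed field of characteristic $0$ and let $\ell$ be a positive integer. For $i=1,\dots,\ell$ let $r_i,d_i$ be positive integers, and let $n\ge \prod_{i=1}^{\ell}\binom{r_i+d_i}{d_i}-1$. For $i=1,\dots,\ell$ let $f_{i0},\dots,f_{in}\in\mathbb{K}[y_0,\dots,y_{r_i}]$ be forms of degree $d_i$, and let $X_i\subset\mathbb{P}^n$ be the parameterized subvariety which is the Zariski closure of $\{[f_{i0}(y):\cdots:f_{in}(y)] : y\in\mathbb{K}^{r_i+1},\ (f_{i0}(y),\dots,f_{in}(y))\neq 0\}$. Let the Hadamard product $X_1\odot\cdots\odot X_\ell\subset\mathbb{P}^n$ be the Zariski closure of the set of all coordinatewise products of points $P_1\in X_1,\dots,P_\ell\in X_\ell$ that are defined (i.e. not all of whose coordinates are zero). By the product variety $X_1\times\cdots\times X_\ell$ as a subvariety of $\mathbb{P}^n$ we mean the following: choose linear subspaces $L_i\cong\mathbb{P}^{h_i}$ of $\mathbb{P}^n$ with $X_i\subseteq L_i$ and $n\ge\prod_i(h_i+1)-1$, regard $X_i$ as a subvariety of $\mathbb{P}^{h_i}$, and take the image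 of $X_1\times\cdots\times X_\ell$ under the Segre embedding of $\mathbb{P}^{h_1}\times\cdots\times\mathbb{P}^{h_\ell}$ into $\mathbb{P}^{\prod_i(h_i+1)-1}$, the latter being embedded in $\mathbb{P}^n$ as a linear subspace. Then for generic forms $f_{ij}$ (that is, for all families of forms $(f_{ij})$ whose coefficients lie in some fixed nonempty Zariski open subset of the affine space of all coefficients), the product variety $X_1\times\cdots\times X_\ell$ exists as a subvariety of $\mathbb{P}^n$ (such $L_i$ can be chosen), and, for every choice made in its construction, some projective linear automorphism of $\mathbb{P}^n$ maps $X_1\odot\cdots\odot X_\ell$ onto it; that is, $X_1\odot\cdots\odot X_\ell$ and $X_1\times\cdots\times X_\ell$ are projectively equivalent as subvarieties of $\mathbb{P}^n$. -/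

import Mathlib

open scoped LinearAlgebra.Projectivization

namespace HadamardVar

/-- Projective `n`-space over `K`, as a set of `K`-points with homogeneous coordinates. -/
abbrev Pn (K : Type*) [Field K] (n : ℕ) : Type _ := ℙ K (Fin (n + 1) → K)

section

variable {K : Type*} [Field K] {n : ℕ}

/-- Zariski closure of a set of points of `ℙⁿ`: the common zeros of all forms that vanish on the
set. (For a form, vanishing does not depend on the choice of homogeneous coordinates.) -/
def zariskiClosure (Z : Set (Pn K n)) : Set (Pn K n) :=
  {P | ∀ (e : ℕ) (F : MvPolynomial (Fin (n + 1)) K), F.IsHomogeneous e →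
    (∀ Q ∈ Z, MvPolynomial.eval Q.rep F = 0) → MvPolynomial.eval P.rep F = 0}

/-- The subvariety of `ℙⁿ` parameterized by `n + 1` forms in `r + 1` variables: the closure of the
set of all points `[f₀(y) : ⋯ : fₙ(y)]` with `f(y) ≠ 0`. -/
def paramVariety {r : ℕ} (f : Fin (n + 1) → MvPolynomial (Fin (r + 1)) K) : Set (Pn K n) :=
  zariskiClosure {R | ∃ (y : Fin (r + 1) → K) (h : (fun j => MvPolynomial.eval y (f j)) ≠ 0),
    R = Projectivization.mk K (fun j => MvPolynomial.eval y (f j)) h}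

/-- The Hadamard product `X₁ ⊙ ⋯ ⊙ X_ℓ` of subsets of `ℙⁿ`: the closure of the set of all
coordinatewise products `P₁ ⊙ ⋯ ⊙ P_ℓ` with `Pᵢ ∈ Xᵢ` that are defined, that is, not all of whose
coordinates vanish. -/
def hadamardProduct {ℓ : ℕ} (X : Fin ℓ → Set (Pn K n)) : Set (Pn K n) :=
  zariskiClosure {R | ∃ P : Fin ℓ → Pn K n, (∀ i, P i ∈ X i) ∧
    ∃ h : (fun j => ∏ i, (P i).rep j) ≠ 0,
      R = Projectivization.mk K (fun j => ∏ i, (P i).rep j) h}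

theorem segre_ne_zero {ℓ : ℕ} {h : Fin ℓ → ℕ} (Q : ∀ i, Pn K (h i)) :
    (fun J : (∀ i, Fin (h i + 1)) => ∏ i, (Q i).rep (J i)) ≠ 0 := by
  choose J hJ using fun i => Function.ne_iff.mp (Q i).rep_nonzero
  intro h0
  exact Finset.prod_ne_zero_iff.mpr (fun i _ => hJ i) (congrFun h0 J)

/-- The Segre embedding of `ℙ^{h₁} × ⋯ × ℙ^{h_ℓ}`; the coordinates of the target are indexed by
the tuples `J` with `0 ≤ Jᵢ ≤ hᵢ`. -/
noncomputable def segre {ℓ : ℕ} {h : Fin ℓ → ℕ} (Q : ∀ i, Pn K (h i)) :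
    ℙ K ((∀ i, Fin (h i + 1)) → K) :=
  Projectivization.mk K (fun J => ∏ i, (Q i).rep (J i)) (segre_ne_zero Q)

/-- `Z` is the product variety `X₁ × ⋯ × X_ℓ`, as a subvariety of `ℙⁿ`: choose linear subspaces
`Lᵢ ⊇ Xᵢ` of `ℙⁿ` with coordinates `φᵢ : ℙ^{hᵢ} ≃ Lᵢ`, and view `Xᵢ` as a subvariety of `ℙ^{hᵢ}`;
then `Z` is the image of `X₁ × ⋯ × X_ℓ` under the Segre embedding of `ℙ^{h₁} × ⋯ × ℙ^{h_ℓ}`,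
whose target is placed in `ℙⁿ` as a linear subspace by `ι`. -/
def IsProductVariety {ℓ : ℕ} (X : Fin ℓ → Set (Pn K n)) (Z : Set (Pn K n)) : Prop :=
  ∃ (h : Fin ℓ → ℕ)
    (φ : ∀ i, (Fin (h i + 1) → K) →ₗ[K] (Fin (n + 1) → K))
    (hφ : ∀ i, Function.Injective (φ i))
    (ι : ((∀ i, Fin (h i + 1)) → K) →ₗ[K] (Fin (n + 1) → K))
    (hι : Function.Injective ι),
    (∀ i, X i ⊆ Set.range (Projectivization.map (φ i) (hφ i))) ∧
    Z = (fun Q : (∀ i, Pn K (h i)) => Projectivization.map ι hι (segre Q)) ''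
      {Q | ∀ i, Projectivization.map (φ i) (hφ i) (Q i) ∈ X i}

/-- `X` and `Y` are projectively equivalent as subvarieties of `ℙⁿ`: some projective linear
automorphism of `ℙⁿ` maps `X` onto `Y`. -/
def ProjectivelyEquivalent (X Y : Set (Pn K n)) : Prop :=
  ∃ g : (Fin (n + 1) → K) ≃ₗ[K] (Fin (n + 1) → K),
    Projectivization.map g.toLinearMap g.injective '' X = Y

end

/-- The exponents of the monomials of degree `d` in `r + 1` variables. -/
abbrev Exponent (r d : ℕ) : Type := {m : Fin (r + 1) →₀ ℕ // m.degree = d}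

/-- `Φ f` holds for generic `f = (f i j)`, where `f i 0, …, f i n` are forms of degree `d i` in
`r i + 1` variables (`1 ≤ i ≤ ℓ`): it holds whenever the coefficients of the `f i j` lie in a certain
nonempty (principal) Zariski open subset of the affine space of all coefficients. -/
def ForGenericForms (K : Type*) [Field K] {ℓ : ℕ} (n : ℕ) (r d : Fin ℓ → ℕ)
    (Φ : (∀ i, Fin (n + 1) → MvPolynomial (Fin (r i + 1)) K) → Prop) : Prop :=
  ∃ D : MvPolynomial ((i : Fin ℓ) × Fin (n + 1) × Exponent (r i) (d i)) K, D ≠ 0 ∧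
    ∀ f : (∀ i, Fin (n + 1) → MvPolynomial (Fin (r i + 1)) K),
      (∀ i j, (f i j).IsHomogeneous (d i)) →
      MvPolynomial.eval (fun s => MvPolynomial.coeff s.2.2.1 (f s.1 s.2.1)) D ≠ 0 →
      Φ f

end HadamardVar

/-!
Each `Xᵢ` is the image of a Veronese variety under the matrix `Aᵢ` of coefficients of the forms
`fᵢⱼ`. The coordinatewise product of the vectors `Aᵢ vᵢ` is the image of the pure tensor `⨂ᵢ vᵢ`
under the face-splitting product `B` of the `Aᵢ`, so `X₁ ⊙ ⋯ ⊙ X_ℓ` is the image under `B` of the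
Segre product of the Veronese varieties. The bound on `n` says that `B` has at least as many rows as
columns, and some maximal minor of `B` is then a nonzero polynomial in the coefficients: with its
rows `j` labelled by multi-indices, it is `1` when `fᵢⱼ` is the monomial with exponent `jᵢ`. Where
it does not vanish, `B` and hence all `Aᵢ` are injective, so both the Hadamard product and the
product variety are images of the same Segre–Veronese variety under injective linear maps. Such maps
preserve closedness, and any two of them differ by a linear automorphism of `K^(n+1)`.
-/

namespace HadamardVar

open MvPolynomial Matrix

section Tensor

variable {K : Type*} {ι : Type*} [Fintype ι] {κ κ' : ι → Type*}

/-- The coordinates `∏ᵢ vᵢ(Jᵢ)` of the pure tensor `⨂ᵢ vᵢ`, with `⨂ᵢ K^{κᵢ}` encoded as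
`K^{∏ᵢ κᵢ}`. -/
def pureTensor [CommMonoid K] (v : ∀ i, κ i → K) : (∀ i, κ i) → K :=
  fun J => ∏ i, v i (J i)

/-- The Kronecker product of a family of matrices: the matrix of the tensor product of the
corresponding linear maps. -/
def kroneckerFamily [CommMonoid K] (A : ∀ i, Matrix (κ' i) (κ i) K) :
    Matrix (∀ i, κ' i) (∀ i, κ i) K :=
  .of fun J' J => ∏ i, A i (J' i) (J i)

/-- The face-splitting (row-wise Kronecker) product of matrices with the same row index. It is the
part of the Kronecker product with rows on the diagonal, hence maps `⨂ᵢ vᵢ` to the coordinatewise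
product of the vectors `Aᵢ vᵢ`. -/
def faceSplitting [CommMonoid K] {μ : Type*} (A : ∀ i, Matrix μ (κ i) K) :
    Matrix μ (∀ i, κ i) K :=
  (kroneckerFamily A).submatrix (fun j _ => j) id

theorem pureTensor_smul [CommMonoid K] (c : ι → K) (v : ∀ i, κ i → K) :
    pureTensor (fun i => c i • v i) = (∏ i, c i) • pureTensor v := by
  funext J
  simp [pureTensor, Finset.prod_mul_distrib]

theorem pureTensor_ne_zero_iff [CommMonoidWithZero K] [Nontrivial K] [NoZeroDivisors K]
    {v : ∀ i, κ i → K} :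
    pureTensor v ≠ 0 ↔ ∀ i, v i ≠ 0 := by
  simp only [Function.ne_iff, pureTensor, Pi.zero_apply, Finset.prod_ne_zero_iff, Finset.mem_univ,
    true_imp_iff]
  exact ⟨fun ⟨J, hJ⟩ i => ⟨J i, hJ i⟩, fun h => Classical.skolem.mp h⟩

theorem pureTensor_update_apply [CommMonoid K] [DecidableEq ι] (v : ∀ i, κ i → K) (J : ∀ i, κ i)
    (i : ι) (m : κ i) :
    pureTensor v (Function.update J i m) = (∏ k ∈ Finset.univ.erase i, v k (J k)) * v i m := by
  rw [pureTensor, ← Finset.prod_erase_mul _ _ (Finset.mem_univ i), Function.update_self]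
  congr 1
  refine Finset.prod_congr rfl fun k hk => ?_
  rw [Function.update_of_ne (Finset.ne_of_mem_erase hk)]

/-- The right-hand side has only coordinates next to `J₀`, so this recovers a pure tensor, up to
scalars, from those coordinates. -/
theorem pureTensor_apply_mul_pow_card [CommMonoid K] [DecidableEq ι] (v : ∀ i, κ i → K)
    (J₀ J : ∀ i, κ i) :
    pureTensor v J * pureTensor v J₀ ^ Fintype.card ι =
      pureTensor v J₀ * ∏ i, pureTensor v (Function.update J₀ i (J i)) := by
  have split (i : ι) : pureTensor v J₀ = (∏ k ∈ Finset.univ.erase i, v k (J₀ k)) * v i (J₀ i) :=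
    (Finset.prod_erase_mul _ _ (Finset.mem_univ i)).symm
  calc pureTensor v J * pureTensor v J₀ ^ Fintype.card ι
      = ∏ i, v i (J i) * ((∏ k ∈ Finset.univ.erase i, v k (J₀ k)) * v i (J₀ i)) := by
        simp only [← split, Finset.prod_mul_distrib, Finset.prod_const, Finset.card_univ]
        rfl
    _ = ∏ i, v i (J₀ i) * ((∏ k ∈ Finset.univ.erase i, v k (J₀ k)) * v i (J i)) :=
        Finset.prod_congr rfl fun i _ => by
          rw [mul_left_comm, mul_comm (v i (J i)), mul_left_comm]
    _ = pureTensor v J₀ * ∏ i, pureTensor v (Function.update J₀ i (J i)) := by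
        simp only [pureTensor_update_apply, Finset.prod_mul_distrib]
        rfl

theorem kroneckerFamily_mulVec_pureTensor [CommSemiring K] [∀ i, Fintype (κ i)] [DecidableEq ι]
    (A : ∀ i, Matrix (κ' i) (κ i) K) (v : ∀ i, κ i → K) :
    kroneckerFamily A *ᵥ pureTensor v = pureTensor fun i => A i *ᵥ v i := by
  funext J'
  simp only [mulVec, dotProduct, kroneckerFamily, of_apply, pureTensor,
    ← Finset.prod_mul_distrib, Fintype.prod_sum]

theorem exists_linearMap_map_pureTensor [CommSemiring K] [∀ i, Finite (κ i)]
    (C : ∀ i, (κ i → K) →ₗ[K] (κ' i → K)) :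
    ∃ T : ((∀ i, κ i) → K) →ₗ[K] ((∀ i, κ' i) → K),
      ∀ v, T (pureTensor v) = pureTensor fun i => C i (v i) := by
  classical
  have (i : ι) := Fintype.ofFinite (κ i)
  refine ⟨(kroneckerFamily fun i => LinearMap.toMatrix' (C i)).mulVecLin, fun v => ?_⟩
  simp only [mulVecLin_apply, kroneckerFamily_mulVec_pureTensor, LinearMap.toMatrix'_mulVec]

theorem faceSplitting_mulVec_pureTensor [CommSemiring K] [∀ i, Fintype (κ i)] [DecidableEq ι]
    {μ : Type*} (A : ∀ i, Matrix μ (κ i) K) (v : ∀ i, κ i → K) :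
    faceSplitting A *ᵥ pureTensor v = fun j => ∏ i, (A i *ᵥ v i) j := by
  funext j
  exact congrFun (kroneckerFamily_mulVec_pureTensor A v) fun _ => j

theorem mulVec_injective_of_faceSplitting [CommRing K] [IsDomain K] [DecidableEq ι] {μ : Type*}
    [∀ i, Fintype (κ i)] [∀ i, Nonempty (κ i)] {A : ∀ i, Matrix μ (κ i) K}
    (hA : Function.Injective (faceSplitting A).mulVec) (i : ι) :
    Function.Injective (A i).mulVec := by
  refine (injective_iff_map_eq_zero (A i).mulVecLin).mpr fun v hv => ?_
  by_contra hne
  let u : ∀ k, κ k → K := Function.update 1 i v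
  have hu (k : ι) : u k ≠ 0 := by
    rcases eq_or_ne k i with rfl | hk
    · simpa [u] using hne
    · simp [u, Function.update_of_ne hk]
  have hAu : faceSplitting A *ᵥ pureTensor u = 0 := by
    rw [faceSplitting_mulVec_pureTensor]
    funext j
    refine Finset.prod_eq_zero (Finset.mem_univ i) ?_
    simpa [u] using congrFun hv j
  exact pureTensor_ne_zero_iff.mpr hu (hA (hAu.trans (mulVec_zero _).symm))

theorem exists_mvPolynomial_faceSplitting_injective {K : Type*} [Field K] [DecidableEq ι]
    [∀ i, Fintype (κ i)] {μ : Type*} [Fintype μ]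
    (hcard : Fintype.card (∀ i, κ i) ≤ Fintype.card μ) :
    ∃ D : MvPolynomial ((i : ι) × μ × κ i) K, D ≠ 0 ∧ ∀ A : ∀ i, Matrix μ (κ i) K,
      eval (fun s => A s.1 s.2.1 s.2.2) D ≠ 0 → Function.Injective (faceSplitting A).mulVec := by
  classical
  obtain ⟨σ⟩ := Function.Embedding.nonempty_of_card_le hcard
  let generic (i : ι) : Matrix μ (κ i) (MvPolynomial ((i : ι) × μ × κ i) K) :=
    .of fun j m => X ⟨i, j, m⟩
  have eval_det (A : ∀ i, Matrix μ (κ i) K) :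
      eval (fun s => A s.1 s.2.1 s.2.2) ((faceSplitting generic).submatrix σ id).det =
        ((faceSplitting A).submatrix σ id).det := by
    rw [RingHom.map_det]
    congr 1
    ext J J'
    simp [faceSplitting, kroneckerFamily, generic]
  refine ⟨((faceSplitting generic).submatrix σ id).det, fun h0 => ?_, fun A hA => ?_⟩
  · cases isEmpty_or_nonempty (∀ i, κ i)
    · simp at h0
    let A₀ (i : ι) : Matrix μ (κ i) K := (1 : Matrix (κ i) (κ i) K).submatrix
      (fun j => Function.invFun σ j i) id
    have hA₀ : (faceSplitting A₀).submatrix σ id = 1 := by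
      ext J J'
      simp [faceSplitting, kroneckerFamily, A₀, Function.leftInverse_invFun σ.injective J,
        one_apply, Finset.prod_ite_zero, _root_.funext_iff]
    simpa [h0, hA₀] using eval_det A₀
  · rw [eval_det] at hA
    exact fun v w hvw => mulVec_injective_of_det_ne_zero hA
      (funext fun J => congrFun hvw (σ J))

end Tensor

section ConeClosure

variable {K : Type*} [CommRing K] {κ κ' : Type*}

/-- The common zeros in the affine space `K^κ` of all forms that vanish on `S`: the affine cone
over the projective Zariski closure of `S`. -/
def coneClosure (S : Set (κ → K)) : Set (κ → K) :=
  {w | ∀ (e : ℕ) (F : MvPolynomial κ K), F.IsHomogeneous e → (∀ v ∈ S, eval v F = 0) →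
    eval w F = 0}

/-- The points of `ℙ(K^κ)` represented by vectors of `S` form a Zariski closed set. The set `S` need
not be a cone, so a vector of the cone closure is only asked to be proportional to one of `S`. -/
def IsProjectivelyClosed (S : Set (κ → K)) : Prop :=
  ∀ w ∈ coneClosure S, w ≠ 0 → ∃ (c : K), ∃ v ∈ S, c • v = w

theorem eval_smul_of_isHomogeneous {F : MvPolynomial κ K} {e : ℕ} (hF : F.IsHomogeneous e) (c : K)
    (v : κ → K) : eval (c • v) F = c ^ e * eval v F := by
  simp only [eval_eq, Finset.mul_sum]
  refine Finset.sum_congr rfl fun m hm => ?_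
  simp only [Pi.smul_apply, smul_eq_mul, mul_pow, Finset.prod_mul_distrib,
    Finset.prod_pow_eq_pow_sum, ← hF.degree_eq_sum_deg_support hm]
  exact mul_left_comm _ _ _

theorem exists_isHomogeneous_eval_eq_eval_map [Finite κ] (L : (κ → K) →ₗ[K] (κ' → K))
    {F : MvPolynomial κ' K} {e : ℕ} (hF : F.IsHomogeneous e) :
    ∃ G : MvPolynomial κ K, G.IsHomogeneous e ∧ ∀ v, eval v G = eval (L v) F := by
  classical
  have := Fintype.ofFinite κ
  refine ⟨aeval (LinearMap.toMatrix' L).toMvPolynomial F, ?_, fun v => ?_⟩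
  · simpa using hF.aeval _ (toMvPolynomial_isHomogeneous (LinearMap.toMatrix' L))
  · have hL (j : κ') : eval v ((LinearMap.toMatrix' L).toMvPolynomial j) = L v j := by
      rw [toMvPolynomial_eval_eq_apply, LinearMap.toMatrix'_mulVec]
    rw [aeval_def, ← coe_eval₂Hom, ← RingHom.comp_apply]
    refine RingHom.congr_fun (ringHom_ext (fun c => ?_) fun j => ?_) F
    · simp
    · simp [hL]

theorem eval_eq_of_mem_coneClosure {S : Set (κ → K)} {F G : MvPolynomial κ K} {e : ℕ}
    (hF : F.IsHomogeneous e) (hG : G.IsHomogeneous e) (h : ∀ v ∈ S, eval v F = eval v G)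
    {w : κ → K} (hw : w ∈ coneClosure S) : eval w F = eval w G := by
  rw [← sub_eq_zero, ← map_sub]
  exact hw e (F - G) (hF.sub hG) fun v hv => by rw [map_sub, h v hv, sub_self]

theorem map_mem_coneClosure [Finite κ] (L : (κ → K) →ₗ[K] (κ' → K)) {S : Set (κ → K)}
    {T : Set (κ' → K)} (hST : ∀ v ∈ S, ∃ c : K, ∃ u ∈ T, c • u = L v) {w : κ → K}
    (hw : w ∈ coneClosure S) : L w ∈ coneClosure T := by
  intro e F hF hFT
  obtain ⟨G, hG, hGF⟩ := exists_isHomogeneous_eval_eq_eval_map L hF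
  rw [← hGF]
  refine hw e G hG fun v hv => ?_
  obtain ⟨c, u, hu, hcu⟩ := hST v hv
  rw [hGF, ← hcu, eval_smul_of_isHomogeneous hF, hFT u hu, mul_zero]

theorem eqOn_coneClosure [Finite κ] {L L' : (κ → K) →ₗ[K] (κ' → K)} {S : Set (κ → K)}
    (h : Set.EqOn L L' S) : Set.EqOn L L' (coneClosure S) := by
  intro w hw
  have hdiff : (L - L') w ∈ coneClosure {0} := map_mem_coneClosure (L - L')
    (fun v hv => ⟨1, 0, Set.mem_singleton _, by simp [h hv]⟩) hw
  rw [← sub_eq_zero]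
  funext j
  simpa using hdiff 1 (X j) (isHomogeneous_X K j) (by simp)

theorem apply_mul_pow_card_of_mem_coneClosure {ι : Type*} [Fintype ι] [DecidableEq ι]
    {κ : ι → Type*} {S : Set (∀ i, κ i → K)} {w : (∀ i, κ i) → K}
    (hw : w ∈ coneClosure (pureTensor '' S)) (J₀ J : ∀ i, κ i) :
    w J * w J₀ ^ Fintype.card ι = w J₀ * ∏ i, w (Function.update J₀ i (J i)) := by
  have hleft : (X J * X J₀ ^ Fintype.card ι : MvPolynomial (∀ i, κ i) K).IsHomogeneous
      (1 + Fintype.card ι) :=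
    (isHomogeneous_X K J).mul (isHomogeneous_X_pow J₀ _)
  have hright : (X J₀ * ∏ i, X (Function.update J₀ i (J i)) :
      MvPolynomial (∀ i, κ i) K).IsHomogeneous (1 + Fintype.card ι) :=
    (isHomogeneous_X K J₀).mul <| by
      simpa using IsHomogeneous.prod Finset.univ _ _ fun i _ =>
        isHomogeneous_X K (Function.update J₀ i (J i))
  have := eval_eq_of_mem_coneClosure hleft hright ?_ hw
  · simpa using this
  · rintro _ ⟨v, -, rfl⟩
    simpa using pureTensor_apply_mul_pow_card v J₀ J

end ConeClosure

section ProjectivelyClosed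

variable {K : Type*} [Field K]

theorem exists_linearMap_leftInverse {V W : Type*} [AddCommGroup V] [Module K V] [AddCommGroup W]
    [Module K W] {L : V →ₗ[K] W} (hL : Function.Injective L) :
    ∃ R : W →ₗ[K] V, Function.LeftInverse R L :=
  (L.exists_leftInverse_of_injective (LinearMap.ker_eq_bot.mpr hL)).imp fun _ => LinearMap.congr_fun

theorem IsProjectivelyClosed.image {κ κ' : Type*} [Finite κ] [Finite κ']
    {S : Set (κ → K)} (hS : IsProjectivelyClosed S)
    {L : (κ → K) →ₗ[K] (κ' → K)} (hL : Function.Injective L) :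
    IsProjectivelyClosed (L '' S) := by
  intro w hw hw0
  obtain ⟨R, hRL⟩ := exists_linearMap_leftInverse hL
  have hLR : L (R w) = w := by
    refine eqOn_coneClosure (L := L ∘ₗ R) (L' := .id) ?_ hw
    rintro _ ⟨v, _, rfl⟩
    simp [hRL _]
  have hRw : R w ∈ coneClosure S := by
    refine map_mem_coneClosure R ?_ hw
    rintro _ ⟨v, hv, rfl⟩
    exact ⟨1, v, hv, by simp [hRL _]⟩
  obtain ⟨c, v, hv, hcv⟩ := hS (R w) hRw fun h0 => hw0 (by rw [← hLR, h0, map_zero])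
  exact ⟨c, L v, ⟨v, hv, rfl⟩, by rw [← map_smul, hcv, hLR]⟩

/-- A tensor in the closure is determined, up to scalars, by its slices through a nonzero coordinate
`J₀`, and the `i`-th slice lies in the closure of `S i`. -/
theorem isProjectivelyClosed_image_pureTensor {ι : Type*} [Fintype ι] {κ : ι → Type*}
    [∀ i, Finite (κ i)] {S : ∀ i, Set (κ i → K)} (hS : ∀ i, IsProjectivelyClosed (S i)) :
    IsProjectivelyClosed (pureTensor '' Set.univ.pi S) := by
  classical
  intro w hw hw0
  obtain ⟨J₀, hJ₀⟩ := Function.ne_iff.mp hw0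
  let slice (i : ι) : ((∀ i, κ i) → K) →ₗ[K] (κ i → K) :=
    LinearMap.funLeft K K (Function.update J₀ i)
  have slice_mem (i : ι) : slice i w ∈ coneClosure (S i) := by
    refine map_mem_coneClosure (slice i) ?_ hw
    rintro _ ⟨v, hv, rfl⟩
    exact ⟨_, v i, hv i trivial, funext fun m => (pureTensor_update_apply v J₀ i m).symm⟩
  have slice_ne_zero (i : ι) : slice i w ≠ 0 := fun h0 => hJ₀ <| by
    simpa [slice, LinearMap.funLeft_apply] using congrFun h0 (J₀ i)
  choose c v hv hcv using fun i => hS i _ (slice_mem i) (slice_ne_zero i)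
  refine ⟨w J₀ * (∏ i, c i) / w J₀ ^ Fintype.card ι, pureTensor v, ⟨v, fun i _ => hv i, rfl⟩, ?_⟩
  have w_update (i : ι) (m : κ i) : w (Function.update J₀ i m) = c i * v i m :=
    (congrFun (hcv i) m).symm
  funext J
  have hJ := apply_mul_pow_card_of_mem_coneClosure hw J₀ J
  simp only [w_update, Finset.prod_mul_distrib] at hJ
  rw [Pi.smul_apply, smul_eq_mul, div_mul_eq_mul_div, div_eq_iff (pow_ne_zero _ hJ₀), hJ, mul_assoc]
  rfl

end ProjectivelyClosed

section Veronese

variable {r d : ℕ}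

theorem mem_finsuppAntidiag_univ_iff_degree_eq {m : Fin (r + 1) →₀ ℕ} :
    m ∈ Finset.univ.finsuppAntidiag d ↔ m.degree = d := by
  simp [Finset.mem_finsuppAntidiag, Finsupp.degree_eq_sum]

instance : Fintype (Exponent r d) :=
  Fintype.subtype (Finset.univ.finsuppAntidiag d) fun _ => mem_finsuppAntidiag_univ_iff_degree_eq

theorem card_exponent (r d : ℕ) : Fintype.card (Exponent r d) = (r + d).choose d := by
  rw [Fintype.card_of_subtype _ fun _ => mem_finsuppAntidiag_univ_iff_degree_eq,
    Finset.card_finsuppAntidiag_nat_eq_choose, Finset.card_univ, Fintype.card_fin]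
  congr 1
  omega

theorem Exponent.sum_eq (m : Exponent r d) : ∑ b, m.1 b = d := by
  rw [← Finsupp.degree_eq_sum, m.2]

/-- The exponent of the monomial `x_a ^ d`. -/
noncomputable def Exponent.single (d : ℕ) (a : Fin (r + 1)) : Exponent r d :=
  ⟨Finsupp.single a d, Finsupp.degree_single a d⟩

/-- The exponent of the monomial `x_a ^ d * x_b`. -/
noncomputable def Exponent.singleAdd (d : ℕ) (a b : Fin (r + 1)) : Exponent r (d + 1) :=
  ⟨Finsupp.single a d + Finsupp.single b 1, by simp⟩

instance : Nonempty (Exponent r d) := ⟨Exponent.single d 0⟩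

instance : Subsingleton (Exponent r 0) :=
  ⟨fun m m' => Subtype.ext <| ((Finsupp.degree_eq_zero_iff _).mp m.2).trans
    ((Finsupp.degree_eq_zero_iff _).mp m'.2).symm⟩

variable {K : Type*}

/-- The affine Veronese map: all monomials of degree `d` evaluated at `y`. -/
def veronese [CommMonoid K] (d : ℕ) (y : Fin (r + 1) → K) : Exponent r d → K :=
  fun m => ∏ b, y b ^ m.1 b

theorem veronese_single [CommMonoid K] (y : Fin (r + 1) → K) (a : Fin (r + 1)) :
    veronese d y (Exponent.single d a) = y a ^ d := by
  simp [veronese, Exponent.single, Finsupp.single_apply, pow_ite]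

theorem veronese_singleAdd [CommMonoid K] (y : Fin (r + 1) → K) (a b : Fin (r + 1)) :
    veronese (d + 1) y (Exponent.singleAdd d a b) = y a ^ d * y b := by
  simp only [veronese, Exponent.singleAdd, Finsupp.add_apply, pow_add, Finset.prod_mul_distrib]
  rw [Finset.prod_eq_single a, Finset.prod_eq_single b] <;>
    simp +contextual [eq_comm]

theorem veronese_pow_eq_prod_single [CommMonoid K] (y : Fin (r + 1) → K) (m : Exponent r d) :
    veronese d y m ^ d = ∏ b, veronese d y (Exponent.single d b) ^ m.1 b := by
  simp only [veronese_single]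
  simp only [veronese, ← Finset.prod_pow, pow_right_comm]

theorem veronese_mul_pow_eq_prod_singleAdd [CommMonoid K] (y : Fin (r + 1) → K) (a : Fin (r + 1))
    (m : Exponent r (d + 1)) :
    veronese (d + 1) y m * veronese (d + 1) y (Exponent.single (d + 1) a) ^ d =
      ∏ b, veronese (d + 1) y (Exponent.singleAdd d a b) ^ m.1 b := by
  simp only [veronese_single, veronese_singleAdd]
  simp only [veronese, mul_pow, Finset.prod_mul_distrib, Finset.prod_pow_eq_pow_sum, m.sum_eq]
  rw [mul_comm, pow_right_comm]

theorem isHomogeneous_prod_X_pow [CommSemiring K] {κ : Type*} (m : Exponent r d)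
    (k : Fin (r + 1) → κ) :
    (∏ b, X (k b) ^ m.1 b : MvPolynomial κ K).IsHomogeneous d := by
  have := IsHomogeneous.prod Finset.univ _ _ fun b _ => isHomogeneous_X_pow (R := K) (k b) (m.1 b)
  rwa [m.sum_eq] at this

theorem exists_single_ne_zero_of_mem_coneClosure [CommRing K] [IsReduced K] {w : Exponent r d → K}
    (hw : w ∈ coneClosure (Set.range (veronese d))) (hw0 : w ≠ 0) :
    ∃ a, w (Exponent.single d a) ≠ 0 := by
  obtain ⟨m, hm⟩ := Function.ne_iff.mp hw0
  have hpow : w m ^ d = ∏ b, w (Exponent.single d b) ^ m.1 b := by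
    have := eval_eq_of_mem_coneClosure (isHomogeneous_X_pow m d)
      (isHomogeneous_prod_X_pow m (Exponent.single d)) ?_ hw
    · simpa using this
    · rintro _ ⟨y, rfl⟩
      simpa using veronese_pow_eq_prod_single y m
  rcases eq_or_ne d 0 with rfl | hd
  · exact ⟨0, by rwa [Subsingleton.elim (Exponent.single 0 0) m]⟩
  obtain ⟨b, -, hb⟩ := Finset.exists_ne_zero_of_sum_ne_zero (m.sum_eq.trans_ne hd)
  refine ⟨b, fun hwb => hm (eq_zero_of_pow_eq_zero (n := d) ?_)⟩
  rw [hpow, Finset.prod_eq_zero (Finset.mem_univ b) (by rw [hwb, zero_pow hb])]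

theorem isProjectivelyClosed_range_veronese [Field K] (r d : ℕ) :
    IsProjectivelyClosed (Set.range (veronese d : (Fin (r + 1) → K) → _)) := by
  intro w hw hw0
  obtain ⟨a, ha⟩ := exists_single_ne_zero_of_mem_coneClosure hw hw0
  cases d with
  | zero =>
    refine ⟨w (Exponent.single 0 a), _, ⟨0, rfl⟩, funext fun m => ?_⟩
    rw [Subsingleton.elim m (Exponent.single 0 a), Pi.smul_apply, veronese_single, pow_zero,
      smul_eq_mul, mul_one]
  | succ e =>
    set p := w (Exponent.single (e + 1) a)
    refine ⟨p, _, ⟨fun b => w (Exponent.singleAdd e a b) / p, rfl⟩, funext fun m => ?_⟩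
    have hwm : w m * p ^ e = ∏ b, w (Exponent.singleAdd e a b) ^ m.1 b := by
      have := eval_eq_of_mem_coneClosure (F := X m * X (Exponent.single (e + 1) a) ^ e)
        (by simpa [add_comm] using (isHomogeneous_X K m).mul (isHomogeneous_X_pow _ e))
        (isHomogeneous_prod_X_pow m (Exponent.singleAdd e a)) ?_ hw
      · simpa using this
      · rintro _ ⟨y, rfl⟩
        simpa using veronese_mul_pow_eq_prod_singleAdd y a m
    simp only [Pi.smul_apply, smul_eq_mul, veronese, div_pow, Finset.prod_div_distrib, ← hwm,
      Finset.prod_pow_eq_pow_sum, m.sum_eq]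
    field_simp
    ring

end Veronese

section CoeffMatrix

variable {K : Type*} [CommSemiring K] {r d : ℕ} {μ : Type*}

/-- The matrix of coefficients of a family of forms of degree `d`: one row for each form, one column
for each monomial. -/
def coeffMatrix (d : ℕ) (f : μ → MvPolynomial (Fin (r + 1)) K) : Matrix μ (Exponent r d) K :=
  .of fun j m => coeff m.1 (f j)

theorem coeffMatrix_mulVec_veronese {f : μ → MvPolynomial (Fin (r + 1)) K}
    (hf : ∀ j, (f j).IsHomogeneous d) (y : Fin (r + 1) → K) :
    coeffMatrix d f *ᵥ veronese d y = fun j => eval y (f j) := by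
  funext j
  have hsupp : (f j).support ⊆ Finset.univ.finsuppAntidiag d := fun m hm =>
    mem_finsuppAntidiag_univ_iff_degree_eq.mpr ((hf j).degree_eq_sum_deg_support hm).symm
  calc (coeffMatrix d f *ᵥ veronese d y) j
      = ∑ m ∈ Finset.univ.finsuppAntidiag d, coeff m (f j) * ∏ b, y b ^ m b :=
        (Finset.sum_subtype _ (fun _ => mem_finsuppAntidiag_univ_iff_degree_eq)
          fun m => coeff m (f j) * ∏ b, y b ^ m b).symm
    _ = ∑ m ∈ (f j).support, coeff m (f j) * ∏ b, y b ^ m b :=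
        (Finset.sum_subset hsupp fun m _ hm => by
          rw [notMem_support_iff.mp hm, zero_mul]).symm
    _ = eval y (f j) := (eval_eq' y (f j)).symm

end CoeffMatrix

section Projectivize

variable {K : Type*} [DivisionRing K] {V W : Type*} [AddCommGroup V] [Module K V] [AddCommGroup W]
  [Module K W]

/-- The set of points of `ℙ(V)` represented by the nonzero vectors of `S`. The set `S` need not be
a cone. -/
def projectivize (S : Set V) : Set (ℙ K V) :=
  {P | ∃ v ∈ S, ∃ h : v ≠ 0, P = .mk K v h}

theorem mk_mem_projectivize_iff {S : Set V} {w : V} (hw : w ≠ 0) :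
    Projectivization.mk K w hw ∈ projectivize S ↔ ∃ c : K, ∃ v ∈ S, c • v = w := by
  refine ⟨fun ⟨v, hv, h, hwv⟩ => ?_, fun ⟨c, v, hv, hcv⟩ => ?_⟩
  · obtain ⟨c, hc⟩ := (Projectivization.mk_eq_mk_iff' K _ _ hw h).mp hwv
    exact ⟨c, v, hv, hc⟩
  · have hv0 : v ≠ 0 := fun h0 => hw (by rw [← hcv, h0, smul_zero])
    exact ⟨v, hv, hv0, (Projectivization.mk_eq_mk_iff' K _ _ hw hv0).mpr ⟨c, hcv⟩⟩

theorem map_image_projectivize {L : V →ₗ[K] W} (hL : Function.Injective L) (S : Set V) :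
    Projectivization.map L hL '' projectivize S = projectivize (L '' S) := by
  ext P
  constructor
  · rintro ⟨_, ⟨v, hv, h, rfl⟩, rfl⟩
    exact ⟨L v, ⟨v, hv, rfl⟩, _, Projectivization.map_mk L hL v h⟩
  · rintro ⟨_, ⟨v, hv, rfl⟩, h, rfl⟩
    have hv0 : v ≠ 0 := fun h0 => h (by rw [h0, map_zero])
    exact ⟨_, ⟨v, hv, hv0, rfl⟩, Projectivization.map_mk L hL v hv0⟩

theorem map_mem_projectivize_iff {L : V →ₗ[K] W} (hL : Function.Injective L) {S : Set W}
    {P : ℙ K V} :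
    Projectivization.map L hL P ∈ projectivize S ↔ P ∈ projectivize (L ⁻¹' S) := by
  induction P using Projectivization.ind with | h w hw
  rw [Projectivization.map_mk, mk_mem_projectivize_iff, mk_mem_projectivize_iff]
  refine ⟨fun ⟨c, v, hv, hcv⟩ => ?_, fun ⟨c, v, hv, hcv⟩ => ⟨c, L v, hv, by rw [← map_smul, hcv]⟩⟩
  have hc : c ≠ 0 := fun h0 => hw (hL (by rw [← hcv, h0, zero_smul, map_zero]))
  exact ⟨c, c⁻¹ • w, by simpa [← hcv, hc] using hv, smul_inv_smul₀ hc w⟩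

theorem subset_range_of_projectivize_subset {L : V →ₗ[K] W} (hL : Function.Injective L)
    {S : Set W} (hS : projectivize S ⊆ Set.range (Projectivization.map L hL)) :
    S ⊆ Set.range L := by
  intro w hw
  rcases eq_or_ne w 0 with rfl | hw0
  · exact ⟨0, map_zero L⟩
  obtain ⟨P, hP⟩ := hS ⟨w, hw, hw0, rfl⟩
  induction P using Projectivization.ind with | h v hv
  rw [Projectivization.map_mk, eq_comm, Projectivization.mk_eq_mk_iff'] at hP
  obtain ⟨c, hc⟩ := hP
  exact ⟨c • v, by rw [map_smul, hc]⟩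

theorem projectivize_subset_range_map {L : V →ₗ[K] W} (hL : Function.Injective L) {S : Set W}
    (hS : S ⊆ Set.range L) : projectivize S ⊆ Set.range (Projectivization.map L hL) := by
  rintro _ ⟨_, hw, h, rfl⟩
  obtain ⟨v, rfl⟩ := hS hw
  exact ⟨.mk K v fun h0 => h (by rw [h0, map_zero]), Projectivization.map_mk ..⟩

end Projectivize

section ProjectiveVarieties

variable {K : Type*} [Field K] {n : ℕ}

/-- The tensor of representatives differs from the tensor of the vectors only by a scalar, so the
choice of representatives in the Segre embedding and in the Hadamard product does not matter. -/
theorem setOf_mk_map_pureTensor_rep_eq_projectivize {ι : Type*} [Fintype ι] {κ : ι → Type*}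
    {V : Type*} [AddCommGroup V] [Module K V] (L : ((∀ i, κ i) → K) →ₗ[K] V)
    (S : ∀ i, Set (κ i → K)) :
    {R | ∃ P : ∀ i, ℙ K (κ i → K), (∀ i, P i ∈ projectivize (S i)) ∧
      ∃ h : L (pureTensor fun i => (P i).rep) ≠ 0,
        R = .mk K (L (pureTensor fun i => (P i).rep)) h} =
      projectivize (L '' (pureTensor '' Set.univ.pi S)) := by
  have smul_eq (v : ∀ i, κ i → K) (hv : ∀ i, v i ≠ 0) : ∃ a : Kˣ,
      a • L (pureTensor v) = L (pureTensor fun i => (Projectivization.mk K (v i) (hv i)).rep) := by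
    choose a ha using fun i => Projectivization.exists_smul_eq_mk_rep K (v i) (hv i)
    refine ⟨∏ i, a i, ?_⟩
    simp only [← ha, Units.smul_def, Units.coe_prod, pureTensor_smul, map_smul]
  ext R
  constructor
  · rintro ⟨P, hP, h, rfl⟩
    choose v hvS hv hPv using hP
    obtain rfl := funext hPv
    obtain ⟨a, ha⟩ := smul_eq v hv
    exact (mk_mem_projectivize_iff h).mpr ⟨a, _, ⟨_, ⟨v, fun i _ => hvS i, rfl⟩, rfl⟩, ha⟩
  · rintro ⟨_, ⟨_, ⟨v, hvS, rfl⟩, rfl⟩, h, rfl⟩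
    have hv : ∀ i, v i ≠ 0 := pureTensor_ne_zero_iff.mp fun h0 => h (by rw [h0, map_zero])
    obtain ⟨a, ha⟩ := smul_eq v hv
    refine ⟨fun i => .mk K (v i) (hv i), fun i => ⟨v i, hvS i trivial, hv i, rfl⟩, ?_, ?_⟩
    · rwa [← ha, ne_eq, smul_eq_zero_iff_eq]
    · rw [eq_comm, Projectivization.mk_eq_mk_iff]
      exact ⟨a, ha⟩

theorem eval_rep_mk_eq_zero_iff {κ : Type*} {F : MvPolynomial κ K} {e : ℕ} (hF : F.IsHomogeneous e)
    {v : κ → K} (hv : v ≠ 0) : eval (Projectivization.mk K v hv).rep F = 0 ↔ eval v F = 0 := by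
  obtain ⟨a, ha⟩ := Projectivization.exists_smul_eq_mk_rep K v hv
  rw [← ha, Units.smul_def, eval_smul_of_isHomogeneous hF]
  simp

theorem zariskiClosure_projectivize {S : Set (Fin (n + 1) → K)} (hS : IsProjectivelyClosed S) :
    zariskiClosure (projectivize S) = projectivize S := by
  refine Set.Subset.antisymm (fun P hP => ?_) fun P hP e F _ h => h P hP
  induction P using Projectivization.ind with | h w hw
  refine (mk_mem_projectivize_iff hw).mpr (hS w (fun e F hF hFS => ?_) hw)
  refine (eval_rep_mk_eq_zero_iff hF hw).mp (hP e F hF ?_)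
  rintro _ ⟨v, hv, h, rfl⟩
  exact (eval_rep_mk_eq_zero_iff hF h).mpr (hFS v hv)

theorem paramVariety_eq_projectivize {r d : ℕ} {f : Fin (n + 1) → MvPolynomial (Fin (r + 1)) K}
    (hf : ∀ j, (f j).IsHomogeneous d) (hinj : Function.Injective (coeffMatrix d f).mulVec) :
    paramVariety f = projectivize ((coeffMatrix d f).mulVecLin '' Set.range (veronese d)) := by
  rw [← zariskiClosure_projectivize ((isProjectivelyClosed_range_veronese r d).image hinj),
    paramVariety, ← Set.range_comp]
  simp only [projectivize, Set.exists_range_iff, Function.comp_apply, mulVecLin_apply,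
    coeffMatrix_mulVec_veronese hf]

theorem hadamardProduct_projectivize {ℓ : ℕ} {κ : Fin ℓ → Type*} [∀ i, Fintype (κ i)]
    {A : ∀ i, Matrix (Fin (n + 1)) (κ i) K} (hA : Function.Injective (faceSplitting A).mulVec)
    {S : ∀ i, Set (κ i → K)} (hS : ∀ i, IsProjectivelyClosed (S i)) :
    hadamardProduct (fun i => projectivize ((A i).mulVecLin '' S i)) =
      projectivize ((faceSplitting A).mulVecLin '' (pureTensor '' Set.univ.pi S)) := by
  rw [← zariskiClosure_projectivize ((isProjectivelyClosed_image_pureTensor hS).image hA),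
    hadamardProduct]
  refine congrArg zariskiClosure ((setOf_mk_map_pureTensor_rep_eq_projectivize
    (LinearMap.funLeft K K fun j _ => j) _).trans (congrArg projectivize ?_))
  rw [← Set.piMap_image_univ_pi, Set.image_image, Set.image_image, Set.image_image]
  refine Set.image_congr fun v _ => ?_
  exact (faceSplitting_mulVec_pureTensor A v).symm

theorem IsProductVariety.exists_eq_projectivize {ℓ : ℕ} {S : Fin ℓ → Set (Fin (n + 1) → K)}
    {Z : Set (Pn K n)} (hZ : IsProductVariety (fun i => projectivize (S i)) Z) :
    ∃ (h : Fin ℓ → ℕ) (φ : ∀ i, (Fin (h i + 1) → K) →ₗ[K] (Fin (n + 1) → K))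
      (ι : ((∀ i, Fin (h i + 1)) → K) →ₗ[K] (Fin (n + 1) → K)),
      (∀ i, Function.Injective (φ i)) ∧ Function.Injective ι ∧ (∀ i, S i ⊆ Set.range (φ i)) ∧
      Z = projectivize (ι '' (pureTensor '' Set.univ.pi fun i => φ i ⁻¹' S i)) := by
  obtain ⟨h, φ, hφ, ι, hι, hS, rfl⟩ := hZ
  refine ⟨h, φ, ι, hφ, hι, fun i => subset_range_of_projectivize_subset (hφ i) (hS i), ?_⟩
  rw [← setOf_mk_map_pureTensor_rep_eq_projectivize]
  ext R
  simp only [map_mem_projectivize_iff]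
  refine exists_congr fun Q => and_congr_right fun _ => ?_
  simp only [segre, Projectivization.map_mk]
  exact ⟨fun hR => ⟨_, hR.symm⟩, fun ⟨_, hR⟩ => hR.symm⟩

theorem exists_isProductVariety {ℓ : ℕ} {κ : Fin ℓ → Type*} [∀ i, Fintype (κ i)]
    [∀ i, Nonempty (κ i)] (hcard : Fintype.card (∀ i, κ i) ≤ n + 1)
    {φ : ∀ i, (κ i → K) →ₗ[K] (Fin (n + 1) → K)} (hφ : ∀ i, Function.Injective (φ i))
    {X : Fin ℓ → Set (Pn K n)} (hX : ∀ i, X i ⊆ Set.range (Projectivization.map (φ i) (hφ i))) :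
    ∃ Z, IsProductVariety X Z := by
  have e (i : Fin ℓ) : Fin (Fintype.card (κ i) - 1 + 1) ≃ κ i :=
    (finCongr (Nat.sub_add_cancel Fintype.card_pos)).trans (Fintype.equivFin (κ i)).symm
  let ψ (i : Fin ℓ) := LinearEquiv.funCongrLeft K K (e i).symm
  obtain ⟨ι, hι⟩ : ∃ ι : ((∀ i, Fin (Fintype.card (κ i) - 1 + 1)) → K) →ₗ[K] (Fin (n + 1) → K),
      Function.Injective ι := by
    rwa [← finrank_le_iff_exists_linearMap, Module.finrank_fintype_fun_eq_card,
      Module.finrank_fin_fun, Fintype.card_congr (Equiv.piCongrRight e)]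
  refine ⟨_, _, fun i => φ i ∘ₗ (ψ i).toLinearMap, fun i => (hφ i).comp (ψ i).injective, ι, hι,
    fun i => (hX i).trans ?_, rfl⟩
  rintro _ ⟨P, rfl⟩
  induction P using Projectivization.ind with | h v hv
  refine ⟨.mk K ((ψ i).symm v) ((ψ i).symm.map_ne_zero_iff.mpr hv), ?_⟩
  simp [Projectivization.map_mk]

theorem projectivelyEquivalent_projectivize_image {S : Set (Fin (n + 1) → K)}
    {F G : (Fin (n + 1) → K) →ₗ[K] (Fin (n + 1) → K)} (hGF : Set.LeftInvOn G F S) :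
    ProjectivelyEquivalent (projectivize S) (projectivize (F '' S)) := by
  have hGF_span : Set.LeftInvOn G F (Submodule.span K S) :=
    LinearMap.eqOn_span (f := G ∘ₗ F) (g := .id) hGF
  obtain ⟨g, hg⟩ := Submodule.exists_linearEquiv_restrict_eq <|
    LinearEquiv.ofInjective (F.domRestrict (Submodule.span K S))
      fun v w h => Subtype.ext (hGF_span.injOn v.2 w.2 h)
  refine ⟨g, ?_⟩
  rw [map_image_projectivize]
  exact congrArg projectivize
    (Set.image_congr fun v hv => (hg ⟨v, Submodule.subset_span hv⟩).symm)

theorem projectivelyEquivalent_image_pureTensor {ι : Type*} [Fintype ι] {κ κ' : ι → Type*}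
    [∀ i, Finite (κ i)] [∀ i, Finite (κ' i)]
    {M : ((∀ i, κ i) → K) →ₗ[K] (Fin (n + 1) → K)} (hM : Function.Injective M)
    {M' : ((∀ i, κ' i) → K) →ₗ[K] (Fin (n + 1) → K)} (hM' : Function.Injective M')
    {C : ∀ i, (κ i → K) →ₗ[K] (κ' i → K)} {C' : ∀ i, (κ' i → K) →ₗ[K] (κ i → K)}
    {S : ∀ i, Set (κ i → K)} (hC : ∀ i, Set.LeftInvOn (C' i) (C i) (S i)) :
    ProjectivelyEquivalent (projectivize (M '' (pureTensor '' Set.univ.pi S)))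
      (projectivize (M' '' (pureTensor '' Set.univ.pi fun i => C i '' S i))) := by
  obtain ⟨R, hR⟩ := exists_linearMap_leftInverse hM
  obtain ⟨R', hR'⟩ := exists_linearMap_leftInverse hM'
  obtain ⟨T, hT⟩ := exists_linearMap_map_pureTensor C
  obtain ⟨T', hT'⟩ := exists_linearMap_map_pureTensor C'
  let F := M' ∘ₗ T ∘ₗ R
  let G := M ∘ₗ T' ∘ₗ R'
  have hF (v : ∀ i, κ i → K) : F (M (pureTensor v)) = M' (pureTensor fun i => C i (v i)) := by
    simp only [F, LinearMap.comp_apply, hR _, hT]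
  have hG (v : ∀ i, κ' i → K) : G (M' (pureTensor v)) = M (pureTensor fun i => C' i (v i)) := by
    simp only [G, LinearMap.comp_apply, hR' _, hT']
  have himage : F '' (M '' (pureTensor '' Set.univ.pi S)) =
      M' '' (pureTensor '' Set.univ.pi fun i => C i '' S i) := by
    rw [← Set.piMap_image_univ_pi]
    simp only [Set.image_image, hF]
    rfl
  rw [← himage]
  refine projectivelyEquivalent_projectivize_image (G := G) ?_
  rintro _ ⟨_, ⟨v, hv, rfl⟩, rfl⟩
  rw [hF, hG]
  congr! with i
  exact hC i (hv i trivial)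

theorem IsProductVariety.projectivelyEquivalent_hadamardProduct {ℓ : ℕ} {κ : Fin ℓ → Type*}
    [∀ i, Fintype (κ i)] [∀ i, Nonempty (κ i)] {A : ∀ i, Matrix (Fin (n + 1)) (κ i) K}
    (hA : Function.Injective (faceSplitting A).mulVec) {S : ∀ i, Set (κ i → K)}
    (hS : ∀ i, IsProjectivelyClosed (S i)) {Z : Set (Pn K n)}
    (hZ : IsProductVariety (fun i => projectivize ((A i).mulVecLin '' S i)) Z) :
    ProjectivelyEquivalent (hadamardProduct fun i => projectivize ((A i).mulVecLin '' S i)) Z := by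
  obtain ⟨h, φ, ι, hφ, hι, hrange, rfl⟩ := hZ.exists_eq_projectivize
  choose φ' hφ' using fun i => exists_linearMap_leftInverse (hφ i)
  choose A' hA' using fun i => exists_linearMap_leftInverse
    (L := (A i).mulVecLin) (mulVec_injective_of_faceSplitting hA i)
  have hφφ' (i : Fin ℓ) {v : κ i → K} (hv : v ∈ S i) :
      φ i (φ' i ((A i).mulVecLin v)) = (A i).mulVecLin v := by
    obtain ⟨u, hu⟩ := hrange i ⟨v, hv, rfl⟩
    rw [← hu]
    exact congrArg (φ i) (hφ' i u)
  have hpreimage (i : Fin ℓ) :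
      φ i ⁻¹' ((A i).mulVecLin '' S i) = (φ' i ∘ₗ (A i).mulVecLin) '' S i := by
    ext u
    constructor
    · rintro ⟨v, hv, hu⟩
      exact ⟨v, hv, hφ i ((hφφ' i hv).trans hu)⟩
    · rintro ⟨v, hv, rfl⟩
      exact ⟨v, hv, (hφφ' i hv).symm⟩
  simp only [hadamardProduct_projectivize hA hS, hpreimage]
  refine projectivelyEquivalent_image_pureTensor hA hι (C' := fun i => A' i ∘ₗ φ i)
    fun i v hv => ?_
  rw [LinearMap.comp_apply, LinearMap.comp_apply, hφφ' i hv]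
  exact hA' i v

end ProjectiveVarieties

end HadamardVar

open HadamardVar in
theorem mainTheorem5_general {K : Type*} [Field K] {ℓ : ℕ} (n : ℕ) (r d : Fin ℓ → ℕ)
    (hn : (∏ i, (r i + d i).choose (d i)) - 1 ≤ n) :
    ForGenericForms K n r d (fun f =>
      (∃ Z, IsProductVariety (fun i => paramVariety (f i)) Z) ∧
      ∀ Z, IsProductVariety (fun i => paramVariety (f i)) Z →
        ProjectivelyEquivalent (hadamardProduct (fun i => paramVariety (f i))) Z) := by
  have hcard : Fintype.card (∀ i, Exponent (r i) (d i)) ≤ Fintype.card (Fin (n + 1)) := by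
    simp only [Fintype.card_pi, card_exponent, Fintype.card_fin]
    omega
  obtain ⟨D, hD0, hD⟩ := exists_mvPolynomial_faceSplitting_injective (K := K) hcard
  refine ⟨D, hD0, fun f hf hDf => ?_⟩
  have hB := hD (fun i => coeffMatrix (d i) (f i)) hDf
  have hA := mulVec_injective_of_faceSplitting hB
  simp only [fun i => paramVariety_eq_projectivize (hf i) (hA i)]
  exact ⟨exists_isProductVariety (by simpa using hcard) hA fun i =>
    projectivize_subset_range_map _ (Set.image_subset_range _ _),
    fun Z hZ => hZ.projectivelyEquivalent_hadamardProduct hB fun i =>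
      isProjectivelyClosed_range_veronese (r i) (d i)⟩

theorem mainTheorem5 {K : Type*} [Field K] [IsAlgClosed K] [CharZero K]
    {ℓ : ℕ} (hℓ : 0 < ℓ) (n : ℕ) (r d : Fin ℓ → ℕ)
    (hr : ∀ i, 0 < r i) (hd : ∀ i, 0 < d i)
    (hn : (∏ i, (r i + d i).choose (d i)) - 1 ≤ n) :
    HadamardVar.ForGenericForms K n r d (fun f =>
      (∃ Z, HadamardVar.IsProductVariety (fun i => HadamardVar.paramVariety (f i)) Z) ∧
      ∀ Z, HadamardVar.IsProductVariety (fun i => HadamardVar.paramVariety (f i)) Z →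
        HadamardVar.ProjectivelyEquivalent
          (HadamardVar.hadamardProduct (fun i => HadamardVar.paramVariety (f i))) Z) :=
  mainTheorem5_general n r d hn
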